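/- Let $\alpha\in\mathbb{R}$ be such that $\alpha/2$ is an odd positive integer. Let $\phi\in L^1_{\mathrm{loc}}(\mathbb{R}^2)$ be a real-valued function which is even, i.e. $\phi(y)=\phi(-y)$ for almost every $y\in\mathbb{R}^2$, has a weak gradient with $$\int_{\mathbb{R}^2}|\nabla\phi(y)|^2\,dy<+\infty,$$ and solves $$-\Delta\phi=2\alpha^2\,\frac{|y|^{\alpha-2}}{(1+|y|^\alpha)^2}\,\phi\quad\text{in }\mathbb{R}^2$$ in the sense of distributions, i.e. $-\int_{\mathbb{R}^2}\phi\,\Delta\psi\,dy=\int_{\mathbb{R}^2}2\alpha^2\frac{|y|^{\alpha-2}}{(1+|y|^\alpha)^2}\,\phi\,\psi\,dy$ for every $\psi\in C_c^\infty(\mathbb{R}^2)$. Then there exists $\gamma\in\mathbb{R}$ such that $$\phi(y)=\gamma\,\frac{1-|y|^\alpha}{1+|y|^\alpha}\quad\text{for almost every }y\in\mathbb{R}^2,$$ and, if $\phi$ is continuous, this holds for every $y\in\mathbb{R}^2$. -/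

import Mathlib

open MeasureTheory
open scoped ContDiff

noncomputable section

/-- The Euclidean plane `ℝ²`, with its Euclidean norm and Lebesgue measure `volume`. -/
abbrev Plane : Type := EuclideanSpace ℝ (Fin 2)

/-- `ψ ∈ C_c^∞(ℝ²)`: a smooth real-valued test function with compact support. -/
def IsTestFunction (ψ : Plane → ℝ) : Prop :=
  ContDiff ℝ ∞ ψ ∧ HasCompactSupport ψ

/-- The vector field `G ∈ L¹_loc(ℝ²; ℝ²)` is the weak (distributional) gradient of
`φ ∈ L¹_loc(ℝ²)`: for every direction `v`, `∫ φ ∂_v ψ = - ∫ (G · v) ψ` for all test functions. -/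
def IsWeakGradient (φ : Plane → ℝ) (G : Plane → Plane) : Prop :=
  LocallyIntegrable φ volume ∧ LocallyIntegrable G volume ∧
    ∀ ψ : Plane → ℝ, IsTestFunction ψ → ∀ v : Plane,
      ∫ y, φ y * fderiv ℝ ψ y v = - ∫ y, inner ℝ (G y) v * ψ y

/-- `∫_{ℝ²} |∇φ|² < ∞`: the function `φ` has a weak gradient, and it is square integrable. -/
def HasFiniteDirichletEnergy (φ : Plane → ℝ) : Prop :=
  ∃ G : Plane → Plane, IsWeakGradient φ G ∧ MemLp G 2 volume

/-- The potential `2 α² |y|^(α-2) / (1 + |y|^α)²`. -/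
def bubblePotential (α : ℝ) (y : Plane) : ℝ :=
  2 * α ^ 2 * (‖y‖ ^ (α - 2) / (1 + ‖y‖ ^ α) ^ 2)

/-- The locally integrable function `φ` solves `-Δφ = 2 α² |y|^(α-2) / (1 + |y|^α)² φ` on the
whole plane in the sense of distributions. -/
def SolvesLinearizedLiouville (α : ℝ) (φ : Plane → ℝ) : Prop :=
  LocallyIntegrable φ volume ∧
    ∀ ψ : Plane → ℝ, IsTestFunction ψ →
      - ∫ y, φ y * Laplacian.laplacian ψ y = ∫ y, bubblePotential α y * φ y * ψ y

end

/-!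
Identify the plane with `ℂ` and put `α = 2m`, `m` odd, `t = |y|²`. Tested against a mode
`h(|y|²) z^k`, the equation becomes an orthogonality relation for the radial operator
`4 (t h'' + (k+1) h') + W h`, where `W(t) = 8 m² t^(m-1) / (1 + t^m)²` (`integral_mode_radialOp`).
Both solutions of the radial equation are explicit: one is
`G = ((k+m) + (k-m) t^m) / (1 + t^m)`, regular at the origin, the other is `t^(-k)` times the same
expression with `-k` in place of `k`, or has a logarithm if `k = 0`. They are independent for
`k ≠ m`. For `u` supported in `(0, ∞)` and orthogonal to `t^k G`, variation of constants produces a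
compactly supported `h`, smooth up to the origin, which the radial operator maps to `u`
(`exists_radialOp_eq`). Hence the pairing of `φ` with `u(|y|²) z^k` is a multiple of `∫ t^k G u`
(`exists_integral_mode_eq`); no regularity of `φ` and no restriction to circles is needed.

The multiples vanish for every `k ≠ 0`. For odd `k` this is evenness of `φ`; here the kernel elements
of frequency `m` disappear, since `m` is odd. For even `k ≠ 0`, so that `k ≠ m`, the regular solution
does not decay and `t^k G` grows like `t^k`, which is incompatible with finite energy: the angular
field `q(|y|²) z^k · (-y₁, y₀)` has divergence `i k q(|y|²) z^k`, which bounds the pairing by the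
energy, and the bound fails for `q(t) = u(t / S²)`, `S → ∞` (`integral_mode_eq_zero_of_energy`).

The frequency `k = 0` provides `γ`, so that `φ - γ (1 - |y|^α) / (1 + |y|^α)` is orthogonal to all
modes. Since `u` may be multiplied by powers of `t`, all moments `z^a z̄^b` of this difference times a
radial cutoff vanish, and by Stone–Weierstrass the difference is zero
(`ae_eq_zero_of_integral_mode_eq_zero`).
-/

/-! ### Calculus of angular modes -/

/-- The standard identification of the plane with `ℂ`, `y ↦ y₀ + i y₁`, as a linear isometry. -/
noncomputable def toC : Plane ≃ₗᵢ[ℝ] ℂ := Complex.orthonormalBasisOneI.repr.symm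

/-- The function `y ↦ h(|y|²) (y₀ + i y₁)^k`, of angular frequency `k`. Writing the radial factor as
a function of `|y|²` keeps it smooth at the origin whenever `h` is smooth. -/
noncomputable def mode (h : ℝ → ℝ) (k : ℕ) (y : Plane) : ℂ := (h (‖y‖ ^ 2) : ℂ) * toC y ^ k

lemma toC_apply (y : Plane) : toC y = y 0 + y 1 * Complex.I :=
  Complex.orthonormalBasisOneI_repr_symm_apply y

lemma norm_mode (h : ℝ → ℝ) (k : ℕ) (y : Plane) : ‖mode h k y‖ = |h (‖y‖ ^ 2)| * ‖y‖ ^ k := by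
  simp [mode]

lemma hasFDerivAt_mode {h : ℝ → ℝ} {h' : ℝ} (k : ℕ) (y : Plane)
    (hh : HasDerivAt h h' (‖y‖ ^ 2)) :
    HasFDerivAt (mode h k) ((toC y ^ k) • (Complex.ofRealCLM.comp (h' • (2 • innerSL ℝ y))) +
      ((h (‖y‖ ^ 2) : ℂ) * (k * toC y ^ (k - 1))) • (toC : Plane →L[ℝ] ℂ)) y := by
  have h1 : HasFDerivAt (fun y : Plane => ‖y‖ ^ 2) (2 • innerSL ℝ y) y :=
    (hasStrictFDerivAt_norm_sq y).hasFDerivAt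
  have h2 := Complex.ofRealCLM.hasFDerivAt.comp y (hh.comp_hasFDerivAt y h1)
  have h3 : HasFDerivAt (fun y : Plane => toC y ^ k)
      ((k * toC y ^ (k - 1)) • (toC : Plane →L[ℝ] ℂ)) y := by
    have := (hasDerivAt_pow k (toC y)).comp_hasFDerivAt (𝕜 := ℝ) y
      ((toC : Plane →L[ℝ] ℂ).hasFDerivAt (x := y))
    exact this
  have h4 := h2.mul h3
  refine (h4.congr_fderiv ?_).congr_of_eventuallyEq (Filter.Eventually.of_forall fun z => rfl)
  rw [add_comm, smul_smul]
  rfl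

lemma fderiv_mode {h : ℝ → ℝ} {h' : ℝ} (k : ℕ) (y : Plane)
    (hh : HasDerivAt h h' (‖y‖ ^ 2)) (w : Plane) :
    fderiv ℝ (mode h k) y w = 2 * h' * inner ℝ y w * toC y ^ k +
      h (‖y‖ ^ 2) * (k * toC y ^ (k - 1)) * toC w := by
  rw [(hasFDerivAt_mode k y hh).fderiv]
  simp
  ring

lemma contDiff_mode {h : ℝ → ℝ} (k : ℕ) (hh : ContDiffOn ℝ ∞ h (Set.Ioi (-1))) :
    ContDiff ℝ ∞ (mode h k) := by
  have h1 : ContDiff ℝ ∞ (fun y : Plane => h (‖y‖ ^ 2)) := by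
    rw [← contDiffOn_univ]
    refine hh.comp (contDiff_norm_sq ℝ).contDiffOn (fun y _ => ?_)
    have := sq_nonneg ‖y‖
    simp only [Set.mem_Ioi]; linarith
  exact (Complex.ofRealCLM.contDiff.comp h1).mul (toC.contDiff.pow k)

lemma hasCompactSupport_mode {h : ℝ → ℝ} (k : ℕ) {R : ℝ} (hR : ∀ t ≥ R, h t = 0) :
    HasCompactSupport (mode h k) := by
  refine HasCompactSupport.intro (isCompact_closedBall (0 : Plane) (max R 1)) (fun y hy => ?_)
  simp only [Metric.mem_closedBall, dist_zero_right, not_le, sup_lt_iff] at hy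
  have : h (‖y‖ ^ 2) = 0 := hR _ (by nlinarith [hy.1, hy.2])
  simp [mode, this]

lemma laplacian_mode {h h₁ h₂ : ℝ → ℝ} (k : ℕ) (hh : ContDiffOn ℝ ∞ h (Set.Ioi (-1)))
    (hd : ∀ t, 0 ≤ t → HasDerivAt h (h₁ t) t) (hd₁ : ∀ t, 0 ≤ t → HasDerivAt h₁ (h₂ t) t)
    (y : Plane) :
    Laplacian.laplacian (mode h k) y =
      mode (fun t => 4 * (t * h₂ t + (k + 1) * h₁ t)) k y := by
  have hC := contDiff_mode k hh
  have key : ∀ v : Plane, iteratedFDeriv ℝ 2 (mode h k) y ![v, v] =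
      (4 * h₂ (‖y‖ ^ 2) * (inner ℝ y v) ^ 2 + 2 * h₁ (‖y‖ ^ 2) * ‖v‖ ^ 2) * toC y ^ k +
      4 * h₁ (‖y‖ ^ 2) * inner ℝ y v * (k * toC y ^ (k - 1)) * toC v +
      h (‖y‖ ^ 2) * (k * ((k - 1 : ℕ) * toC y ^ (k - 1 - 1))) * toC v ^ 2 := by
    intro v
    rw [iteratedFDeriv_two_apply]
    simp only [Matrix.cons_val_zero, Matrix.cons_val_one]
    have hdf : DifferentiableAt ℝ (fderiv ℝ (mode h k)) y :=
      ((hC.fderiv_right (m := 1) (by norm_cast)).differentiable (by norm_num)).differentiableAt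
    have e1 : fderiv ℝ (fun z => fderiv ℝ (mode h k) z v) y v =
        fderiv ℝ (fderiv ℝ (mode h k)) y v v := by
      rw [fderiv_clm_apply hdf (differentiableAt_const v)]
      simp
    rw [← e1]
    have e2 : (fun z => fderiv ℝ (mode h k) z v) = fun z =>
        (2 * ((inner ℝ z v : ℝ) : ℂ)) * mode h₁ k z + (k * toC v) * mode h (k - 1) z := by
      funext z
      rw [fderiv_mode k z (hd _ (sq_nonneg _))]
      simp only [mode]; ring
    rw [e2]
    have d0 : HasFDerivAt (fun z : Plane => (2 * ((inner ℝ z v : ℝ) : ℂ)))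
        ((2 : ℂ) • (Complex.ofRealCLM.comp (innerSL ℝ v))) y := by
      have := ((Complex.ofRealCLM.comp (innerSL ℝ v)).hasFDerivAt (x := y)).const_mul (2 : ℂ)
      refine this.congr_of_eventuallyEq (Filter.Eventually.of_forall fun z => ?_)
      simp [real_inner_comm]
    have d1 := d0.mul (hasFDerivAt_mode k y (hd₁ _ (sq_nonneg _)))
    have d2 := (hasFDerivAt_mode (k - 1) y (hd _ (sq_nonneg _))).const_mul ((k : ℂ) * toC v)
    have d3 := (d1.add d2).fderiv
    simp only [Pi.add_def, Pi.mul_def] at d3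
    rw [d3]
    simp [mode]
    ring
  rw [InnerProductSpace.laplacian_eq_iteratedFDeriv_orthonormalBasis _
    (EuclideanSpace.basisFun (Fin 2) ℝ)]
  simp only [key, Fin.sum_univ_two]
  have n0 : ‖y‖ ^ 2 = y 0 ^ 2 + y 1 ^ 2 := by simp [EuclideanSpace.norm_sq_eq]
  have t0 : toC (EuclideanSpace.basisFun (Fin 2) ℝ 0) = 1 := by simp [toC_apply]
  have t1 : toC (EuclideanSpace.basisFun (Fin 2) ℝ 1) = Complex.I := by simp [toC_apply]
  have i0 : inner ℝ y (EuclideanSpace.basisFun (Fin 2) ℝ 0) = y 0 := by simp [PiLp.inner_apply]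
  have i1 : inner ℝ y (EuclideanSpace.basisFun (Fin 2) ℝ 1) = y 1 := by simp [PiLp.inner_apply]
  have hk : (k : ℂ) * toC y ^ k = k * toC y ^ (k - 1) * toC y := by
    rcases k with _ | k
    · simp
    · simp [pow_succ, mul_assoc]
  have m0 : ((‖y‖ ^ 2 : ℝ) : ℂ) = (y 0 : ℂ) ^ 2 + (y 1 : ℂ) ^ 2 := by rw [n0]; push_cast; ring
  rw [t0, t1, i0, i1]
  simp only [OrthonormalBasis.norm_eq_one, mode]
  push_cast at m0 ⊢
  have expand : (4 * ((‖y‖ : ℂ) ^ 2 * (h₂ (‖y‖ ^ 2) : ℂ) + ((k : ℂ) + 1) * (h₁ (‖y‖ ^ 2) : ℂ))) *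
      toC y ^ k = 4 * ((y 0 : ℂ) ^ 2 + (y 1 : ℂ) ^ 2) * h₂ (‖y‖ ^ 2) * toC y ^ k +
      4 * h₁ (‖y‖ ^ 2) * toC y ^ k + 4 * h₁ (‖y‖ ^ 2) * (k * toC y ^ (k - 1) * toC y) := by
    rw [← hk, m0]; ring
  rw [expand]
  linear_combination (-4 * h₁ (‖y‖ ^ 2) * (k * toC y ^ (k - 1))) * toC_apply y +
    (h (‖y‖ ^ 2) * (k * ((k - 1 : ℕ) * toC y ^ (k - 1 - 1)))) * Complex.I_sq

/-! ### Complex test functions -/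

lemma integrable_ofReal_mul {f : Plane → ℝ} {g : Plane → ℂ} (hf : LocallyIntegrable f volume)
    (hg : Continuous g) (hc : HasCompactSupport g) : Integrable (fun y => (f y : ℂ) * g y) := by
  have h1 : LocallyIntegrable (fun y => (f y : ℂ)) volume := by
    intro x
    obtain ⟨s, hs, hi⟩ := hf x
    exact ⟨s, hs, hi.ofReal⟩
  have := h1.integrable_smul_right_of_hasCompactSupport hg hc
  simpa [smul_eq_mul] using this

lemma re_integral_ofReal_mul {f : Plane → ℝ} {g : Plane → ℂ} (hf : LocallyIntegrable f volume)
    (hg : Continuous g) (hc : HasCompactSupport g) :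
    (∫ y, (f y : ℂ) * g y).re = ∫ y, f y * (g y).re := by
  have := Complex.reCLM.integral_comp_comm (integrable_ofReal_mul hf hg hc)
  simp at this
  exact this.symm

lemma im_integral_ofReal_mul {f : Plane → ℝ} {g : Plane → ℂ} (hf : LocallyIntegrable f volume)
    (hg : Continuous g) (hc : HasCompactSupport g) :
    (∫ y, (f y : ℂ) * g y).im = ∫ y, f y * (g y).im := by
  have := Complex.imCLM.integral_comp_comm (integrable_ofReal_mul hf hg hc)
  simp at this
  exact this.symm

lemma isTestFunction_clm_comp {ψ : Plane → ℂ} (L : ℂ →L[ℝ] ℝ) (hψ : ContDiff ℝ ∞ ψ)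
    (hc : HasCompactSupport ψ) : IsTestFunction (fun y => L (ψ y)) :=
  ⟨L.contDiff.comp hψ, hc.comp_left (map_zero L)⟩

lemma continuous_laplacian {ψ : Plane → ℂ} (hψ : ContDiff ℝ ∞ ψ) :
    Continuous (Laplacian.laplacian ψ) := by
  rw [InnerProductSpace.laplacian_eq_iteratedFDeriv_orthonormalBasis ψ
    (EuclideanSpace.basisFun (Fin 2) ℝ)]
  have h2 : Continuous (iteratedFDeriv ℝ 2 ψ) :=
    hψ.continuous_iteratedFDeriv (m := 2) (by norm_cast)
  fun_prop

lemma hasCompactSupport_laplacian {ψ : Plane → ℂ} (hc : HasCompactSupport ψ) :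
    HasCompactSupport (Laplacian.laplacian ψ) := by
  rw [InnerProductSpace.laplacian_eq_iteratedFDeriv_orthonormalBasis ψ
    (EuclideanSpace.basisFun (Fin 2) ℝ)]
  refine HasCompactSupport.intro hc (fun y hy => ?_)
  have : iteratedFDeriv ℝ 2 ψ y = 0 := by
    by_contra h
    exact hy (support_iteratedFDeriv_subset 2 h)
  simp [this]

lemma weak_equation_complex {α : ℝ} {φ : Plane → ℝ} (hφ : SolvesLinearizedLiouville α φ)
    (hV : Continuous (bubblePotential α)) {ψ : Plane → ℂ} (hψ : ContDiff ℝ ∞ ψ)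
    (hc : HasCompactSupport ψ) :
    ∫ y, (φ y : ℂ) * (Laplacian.laplacian ψ y + bubblePotential α y * ψ y) = 0 := by
  have hΔ := continuous_laplacian hψ
  have hΔc := hasCompactSupport_laplacian hc
  have hVψ : Continuous (fun y => (bubblePotential α y : ℂ) * ψ y) :=
    (Complex.continuous_ofReal.comp hV).mul hψ.continuous
  have hVψc : HasCompactSupport (fun y => (bubblePotential α y : ℂ) * ψ y) := hc.mul_left
  have hψ2 : ∀ y, ContDiffAt ℝ 2 ψ y := fun y => hψ.contDiffAt.of_le (by norm_cast)
  simp only [mul_add]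
  rw [integral_add (integrable_ofReal_mul hφ.1 hΔ hΔc) (integrable_ofReal_mul hφ.1 hVψ hVψc)]
  apply Complex.ext
  · rw [Complex.add_re, re_integral_ofReal_mul hφ.1 hΔ hΔc, re_integral_ofReal_mul hφ.1 hVψ hVψc]
    have h := hφ.2 _ (isTestFunction_clm_comp Complex.reCLM hψ hc)
    have e : ∀ y, Laplacian.laplacian (fun y => Complex.reCLM (ψ y)) y =
        (Laplacian.laplacian ψ y).re := fun y =>
      (hψ2 y).laplacian_CLM_comp_left (l := Complex.reCLM)
    simp only [e] at h
    simp only [Complex.mul_re, Complex.ofReal_re, Complex.ofReal_im, zero_mul, sub_zero,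
      Complex.zero_re]
    simp only [Complex.reCLM_apply] at h
    have e2 : ∫ y, φ y * (bubblePotential α y * (ψ y).re) =
        ∫ y, bubblePotential α y * φ y * (ψ y).re := by congr 1; ext y; ring
    linarith
  · rw [Complex.add_im, im_integral_ofReal_mul hφ.1 hΔ hΔc, im_integral_ofReal_mul hφ.1 hVψ hVψc]
    have h := hφ.2 _ (isTestFunction_clm_comp Complex.imCLM hψ hc)
    have e : ∀ y, Laplacian.laplacian (fun y => Complex.imCLM (ψ y)) y =
        (Laplacian.laplacian ψ y).im := fun y =>
      (hψ2 y).laplacian_CLM_comp_left (l := Complex.imCLM)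
    simp only [e] at h
    simp only [Complex.mul_im, Complex.ofReal_re, Complex.ofReal_im, zero_mul, add_zero,
      Complex.zero_im]
    simp only [Complex.imCLM_apply] at h
    have e2 : ∫ y, φ y * (bubblePotential α y * (ψ y).im) =
        ∫ y, bubblePotential α y * φ y * (ψ y).im := by congr 1; ext y; ring
    linarith

lemma weak_gradient_complex {φ : Plane → ℝ} {G : Plane → Plane} (hG : IsWeakGradient φ G)
    {ψ : Plane → ℂ} (hψ : ContDiff ℝ ∞ ψ) (hc : HasCompactSupport ψ) (v : Plane) :
    ∫ y, (φ y : ℂ) * fderiv ℝ ψ y v = - ∫ y, ((inner ℝ (G y) v : ℝ) : ℂ) * ψ y := by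
  have hD : Continuous (fun y => fderiv ℝ ψ y v) :=
    (hψ.continuous_fderiv (by norm_num)).clm_apply continuous_const
  have hDc : HasCompactSupport (fun y => fderiv ℝ ψ y v) := hc.fderiv_apply ℝ v
  have hGv : LocallyIntegrable (fun y => inner ℝ (G y) v) volume := by
    intro x
    obtain ⟨s, hs, hi⟩ := hG.2.1 x
    exact ⟨s, hs, hi.inner_const v⟩
  have hd : ∀ y, DifferentiableAt ℝ ψ y := fun y => (hψ.differentiable (by norm_num)) y
  apply Complex.ext
  · rw [Complex.neg_re, re_integral_ofReal_mul hG.1 hD hDc,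
      re_integral_ofReal_mul hGv hψ.continuous hc]
    have h := hG.2.2 _ (isTestFunction_clm_comp Complex.reCLM hψ hc) v
    have e : ∀ y, fderiv ℝ (fun y => Complex.reCLM (ψ y)) y v = (fderiv ℝ ψ y v).re := fun y => by
      have := (Complex.reCLM.hasFDerivAt.comp y (hd y).hasFDerivAt).fderiv
      simp only [Function.comp_def] at this
      rw [this]; rfl
    simp only [e] at h
    exact h
  · rw [Complex.neg_im, im_integral_ofReal_mul hG.1 hD hDc,
      im_integral_ofReal_mul hGv hψ.continuous hc]
    have h := hG.2.2 _ (isTestFunction_clm_comp Complex.imCLM hψ hc) v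
    have e : ∀ y, fderiv ℝ (fun y => Complex.imCLM (ψ y)) y v = (fderiv ℝ ψ y v).im := fun y => by
      have := (Complex.imCLM.hasFDerivAt.comp y (hd y).hasFDerivAt).fderiv
      simp only [Function.comp_def] at this
      rw [this]; rfl
    simp only [e] at h
    exact h

/-! ### The equation and the energy tested against an angular mode -/

/-- The potential `2 α² |y|^(α-2) / (1 + |y|^α)²` for `α = 2m`, in the variable `t = |y|²`. -/
noncomputable def radialPotential (m : ℕ) (t : ℝ) : ℝ := 8 * m ^ 2 * t ^ (m - 1) / (1 + t ^ m) ^ 2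

lemma rpow_two_mul_natCast (m : ℕ) (y : Plane) : ‖y‖ ^ (2 * m : ℝ) = (‖y‖ ^ 2) ^ m := by
  rw [← pow_mul, ← Real.rpow_natCast]; push_cast; rfl

lemma bubblePotential_eq {m : ℕ} (hm : 1 ≤ m) (y : Plane) :
    bubblePotential (2 * m) y = radialPotential m (‖y‖ ^ 2) := by
  have h1 : ‖y‖ ^ (2 * m - 2 : ℝ) = (‖y‖ ^ 2) ^ (m - 1) := by
    rw [← rpow_two_mul_natCast]; push_cast [hm]; ring_nf
  rw [bubblePotential, radialPotential, h1, rpow_two_mul_natCast]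
  ring

lemma continuous_bubblePotential {m : ℕ} (hm : 1 ≤ m) :
    Continuous (bubblePotential (2 * m)) := by
  have : bubblePotential (2 * m) = fun y => radialPotential m (‖y‖ ^ 2) :=
    funext (bubblePotential_eq hm)
  rw [this]
  unfold radialPotential
  refine Continuous.div (by fun_prop) (by fun_prop) (fun y => ?_)
  positivity

/-- The differential operator `4 (t ∂ₜ² + (k+1) ∂ₜ) + W` that the linearized equation induces on the
radial factor of a mode of frequency `k`, for a function with derivatives `h₁`, `h₂`. -/
noncomputable def radialOp (m k : ℕ) (h h₁ h₂ : ℝ → ℝ) (t : ℝ) : ℝ :=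
  4 * (t * h₂ t + (k + 1) * h₁ t) + radialPotential m t * h t

lemma integral_mode_radialOp {m : ℕ} (hm : 1 ≤ m) {φ : Plane → ℝ}
    (hφ : SolvesLinearizedLiouville (2 * m) φ) (k : ℕ) {h h₁ h₂ : ℝ → ℝ}
    (hh : ContDiffOn ℝ ∞ h (Set.Ioi (-1)))
    (hd : ∀ t, 0 ≤ t → HasDerivAt h (h₁ t) t) (hd₁ : ∀ t, 0 ≤ t → HasDerivAt h₁ (h₂ t) t)
    {R : ℝ} (hR : ∀ t ≥ R, h t = 0) :
    ∫ y, (φ y : ℂ) * mode (radialOp m k h h₁ h₂) k y = 0 := by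
  rw [← weak_equation_complex hφ (continuous_bubblePotential hm) (contDiff_mode k hh)
    (hasCompactSupport_mode k hR)]
  congr 1
  ext y
  rw [laplacian_mode k hh hd hd₁, bubblePotential_eq hm]
  simp only [mode, radialOp]
  push_cast
  ring

/-- The weak gradient tested against the angular field `q(|y|²) z^k · (-y₁, y₀)`, whose divergence is
`i k q(|y|²) z^k`. -/
lemma integral_mode_eq_gradient {φ : Plane → ℝ} {G : Plane → Plane} (hG : IsWeakGradient φ G)
    (k : ℕ) {q : ℝ → ℝ} (hq : ContDiff ℝ ∞ q) {R : ℝ} (hR : ∀ t ≥ R, q t = 0) :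
    Complex.I * k * ∫ y, (φ y : ℂ) * mode q k y =
      - ∫ y, ((y 0 * G y 1 - y 1 * G y 0 : ℝ) : ℂ) * mode q k y := by
  have hC := contDiff_mode k hq.contDiffOn
  have hc := hasCompactSupport_mode k hR
  have hcoord : ∀ i : Fin 2, ContDiff ℝ ∞ (fun y : Plane => ((y i : ℝ) : ℂ)) := fun i =>
    Complex.ofRealCLM.contDiff.comp (by fun_prop)
  have hf : ∀ i : Fin 2, ContDiff ℝ ∞ (fun y : Plane => ((y i : ℝ) : ℂ) * mode q k y) :=
    fun i => (hcoord i).mul hC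
  have hfc : ∀ i : Fin 2, HasCompactSupport (fun y : Plane => ((y i : ℝ) : ℂ) * mode q k y) :=
    fun i => hc.mul_left
  have w0 := weak_gradient_complex hG (hf 1) (hfc 1) (EuclideanSpace.basisFun (Fin 2) ℝ 0)
  have w1 := weak_gradient_complex hG (hf 0) (hfc 0) (EuclideanSpace.basisFun (Fin 2) ℝ 1)
  have hD : ∀ i (v : Plane), Integrable (fun y => (φ y : ℂ) *
      fderiv ℝ (fun y : Plane => ((y i : ℝ) : ℂ) * mode q k y) y v) := fun i v =>
    integrable_ofReal_mul hG.1 (((hf i).continuous_fderiv (by norm_num)).clm_apply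
      continuous_const) ((hfc i).fderiv_apply ℝ v)
  have hGv : ∀ v : Plane, LocallyIntegrable (fun y => inner ℝ (G y) v) volume := by
    intro v x
    obtain ⟨s, hs, hi⟩ := hG.2.1 x
    exact ⟨s, hs, hi.inner_const v⟩
  have hI : ∀ i (v : Plane), Integrable (fun y => ((inner ℝ (G y) v : ℝ) : ℂ) *
      (((y i : ℝ) : ℂ) * mode q k y)) := fun i v =>
    integrable_ofReal_mul (hGv v) (hf i).continuous (hfc i)
  have e1 : ∀ y, Complex.I * k * ((φ y : ℂ) * mode q k y) =
      (φ y : ℂ) * fderiv ℝ (fun y : Plane => ((y 0 : ℝ) : ℂ) * mode q k y) y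
          (EuclideanSpace.basisFun (Fin 2) ℝ 1) -
      (φ y : ℂ) * fderiv ℝ (fun y : Plane => ((y 1 : ℝ) : ℂ) * mode q k y) y
          (EuclideanSpace.basisFun (Fin 2) ℝ 0) := by
    intro y
    have hqd : HasDerivAt q (deriv q (‖y‖ ^ 2)) (‖y‖ ^ 2) :=
      (hq.differentiable (by norm_num) _).hasDerivAt
    have hder : ∀ (i : Fin 2) (v : Plane),
        fderiv ℝ (fun y : Plane => ((y i : ℝ) : ℂ) * mode q k y) y v =
        (y i : ℂ) * fderiv ℝ (mode q k) y v + mode q k y * (v i : ℂ) := by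
      intro i v
      have c1 : HasFDerivAt (fun y : Plane => ((y i : ℝ) : ℂ))
          (Complex.ofRealCLM.comp (EuclideanSpace.proj i : Plane →L[ℝ] ℝ)) y :=
        (Complex.ofRealCLM.comp (EuclideanSpace.proj i : Plane →L[ℝ] ℝ)).hasFDerivAt
      have := (c1.mul ((hC.differentiable (by norm_num)) y).hasFDerivAt).fderiv
      simp only [Pi.mul_def] at this
      rw [this]
      simp
    rw [hder, hder, fderiv_mode k y hqd, fderiv_mode k y hqd]
    have hk : (k : ℂ) * toC y ^ k = k * toC y ^ (k - 1) * toC y := by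
      rcases k with _ | k
      · simp
      · simp [pow_succ, mul_assoc]
    have i0 : inner ℝ y (EuclideanSpace.basisFun (Fin 2) ℝ 0) = y 0 := by simp [PiLp.inner_apply]
    have i1 : inner ℝ y (EuclideanSpace.basisFun (Fin 2) ℝ 1) = y 1 := by simp [PiLp.inner_apply]
    have t0 : toC (EuclideanSpace.basisFun (Fin 2) ℝ 0) = 1 := by simp [toC_apply]
    have t1 : toC (EuclideanSpace.basisFun (Fin 2) ℝ 1) = Complex.I := by simp [toC_apply]
    rw [i0, i1, t0, t1]
    simp [mode]
    linear_combination (Complex.I * φ y * q (‖y‖ ^ 2)) * hk +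
      (Complex.I * φ y * q (‖y‖ ^ 2) * k * toC y ^ (k - 1)) * toC_apply y +
      (φ y * q (‖y‖ ^ 2) * k * toC y ^ (k - 1) * y 1) * Complex.I_sq
  rw [← integral_const_mul]
  simp only [e1]
  rw [integral_sub (hD 0 _) (hD 1 _), w0, w1]
  have e3 : ∀ y, ((y 0 * G y 1 - y 1 * G y 0 : ℝ) : ℂ) * mode q k y =
      ((inner ℝ (G y) (EuclideanSpace.basisFun (Fin 2) ℝ 1) : ℝ) : ℂ) *
      (((y 0 : ℝ) : ℂ) * mode q k y) -
      ((inner ℝ (G y) (EuclideanSpace.basisFun (Fin 2) ℝ 0) : ℝ) : ℂ) *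
      (((y 1 : ℝ) : ℂ) * mode q k y) := by
    intro y
    simp [PiLp.inner_apply]
    ring
  simp only [e3]
  rw [integral_sub (hI 0 _) (hI 1 _)]
  ring

/-- Finite energy controls the modes: by Young's inequality with weight `lam`, a cutoff of size one
supported in `|y| < S` pairs with the mode of frequency `k` at the cost of the energy and of the
`L²` norm of the angular test field. -/
lemma norm_integral_mode_le {φ : Plane → ℝ} {G : Plane → Plane} (hG : IsWeakGradient φ G)
    (hL : MemLp G 2 volume) (k : ℕ) {q : ℝ → ℝ} (hq : ContDiff ℝ ∞ q) (hq1 : ∀ t, |q t| ≤ 1)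
    {S : ℝ} (hS : 0 < S) (hR : ∀ t ≥ S ^ 2, q t = 0) {lam : ℝ} (hlam : 0 < lam) :
    k * ‖∫ y, (φ y : ℂ) * mode q k y‖ ≤
      lam * (∫ y, ‖G y‖ ^ 2) + Real.pi * S ^ (2 * k + 4) / lam := by
  have hid := congrArg norm (integral_mode_eq_gradient hG k hq hR)
  simp only [norm_mul, Complex.norm_I, one_mul, Complex.norm_natCast, norm_neg] at hid
  rw [hid]
  have hG2 : Integrable (fun y => ‖G y‖ ^ 2) := (memLp_two_iff_integrable_sq_norm hL.1).1 hL
  have hball : Integrable ((Metric.ball (0 : Plane) S).indicator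
      (fun _ => S ^ (2 * k + 2) / lam)) volume :=
    (integrable_indicator_iff measurableSet_ball).2
      (integrableOn_const measure_ball_lt_top.ne)
  have hpt : ∀ y : Plane, ‖((y 0 * G y 1 - y 1 * G y 0 : ℝ) : ℂ) * mode q k y‖ ≤
      lam * ‖G y‖ ^ 2 + (Metric.ball (0 : Plane) S).indicator
      (fun _ => S ^ (2 * k + 2) / lam) y := by
    intro y
    by_cases hy : y ∈ Metric.ball (0 : Plane) S
    · rw [Set.indicator_of_mem hy]
      have hyS : ‖y‖ ≤ S := by simpa using (Metric.mem_ball.1 hy).le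
      rw [norm_mul, norm_mode, Complex.norm_real, Real.norm_eq_abs]
      have c1 : |y 0 * G y 1 - y 1 * G y 0| ≤ ‖y‖ * ‖G y‖ := by
        have n1 : ‖y‖ ^ 2 = y 0 ^ 2 + y 1 ^ 2 := by simp [EuclideanSpace.norm_sq_eq]
        have n2 : ‖G y‖ ^ 2 = G y 0 ^ 2 + G y 1 ^ 2 := by simp [EuclideanSpace.norm_sq_eq]
        apply abs_le_of_sq_le_sq _ (by positivity)
        rw [mul_pow, n1, n2]
        nlinarith [sq_nonneg (y 0 * G y 0 + y 1 * G y 1)]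
      have c2 : |y 0 * G y 1 - y 1 * G y 0| * (|q (‖y‖ ^ 2)| * ‖y‖ ^ k) ≤
          ‖G y‖ * S ^ (k + 1) := by
        calc _ ≤ (‖y‖ * ‖G y‖) * (1 * ‖y‖ ^ k) := by
              gcongr; exact hq1 _
          _ = ‖G y‖ * ‖y‖ ^ (k + 1) := by ring
          _ ≤ _ := by gcongr
      refine c2.trans ?_
      have : S ^ (2 * k + 2) / lam = lam * (S ^ (k + 1) / lam) ^ 2 := by
        field_simp; ring
      have e : ‖G y‖ * S ^ (k + 1) = lam * (‖G y‖ * (S ^ (k + 1) / lam)) := by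
        field_simp
      rw [this, e, ← mul_add]
      gcongr
      nlinarith [sq_nonneg (‖G y‖ - S ^ (k + 1) / lam), sq_nonneg (‖G y‖),
        sq_nonneg (S ^ (k + 1) / lam)]
    · rw [Set.indicator_of_notMem hy]
      have hyS : S ≤ ‖y‖ := by simpa using hy
      have : q (‖y‖ ^ 2) = 0 := hR _ (by gcongr)
      simp [mode, this]
      positivity
  refine (norm_integral_le_of_norm_le ((hG2.const_mul lam).add hball)
    (Filter.Eventually.of_forall hpt)).trans (le_of_eq ?_)
  simp only [Pi.add_apply]
  rw [integral_add (hG2.const_mul lam) hball, integral_const_mul,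
    integral_indicator_const _ measurableSet_ball]
  congr 1
  rw [Measure.real, EuclideanSpace.volume_ball_fin_two]
  simp [hS.le, Real.pi_pos.le]
  field_simp
  ring

/-! ### The radial equation -/

/-- The function `((κ + m) + (κ - m) t^m) / (1 + t^m)`, written as `(κ - m) + 2m / (1 + t^m)`. For
`κ = k` it is the solution of the radial equation of frequency `k` that is regular at the origin,
and `t ^ (-k)` times its value for `κ = -k` is a second solution. -/
noncomputable def regSol (m : ℕ) (κ t : ℝ) : ℝ := (κ - m) + 2 * m / (1 + t ^ m)

/-- The derivative of `regSol m κ`, which does not depend on `κ`. -/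
noncomputable def regSolD (m : ℕ) (t : ℝ) : ℝ := -(2 * m) * (m * t ^ (m - 1)) / (1 + t ^ m) ^ 2

/-- The second derivative of `regSol m κ`. -/
noncomputable def regSolDD (m : ℕ) (t : ℝ) : ℝ :=
  -(2 * m) * (m * ((m - 1 : ℕ) * t ^ (m - 1 - 1))) / (1 + t ^ m) ^ 2 +
    (4 * m) * (m * t ^ (m - 1)) ^ 2 / (1 + t ^ m) ^ 3

lemma one_add_pow_pos_of_odd {m : ℕ} (hm : Odd m) {t : ℝ} (ht : -1 < t) : 0 < 1 + t ^ m := by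
  have := hm.strictMono_pow ht
  simp only [hm.neg_one_pow] at this
  linarith

lemma contDiffOn_regSol {m : ℕ} (hm : Odd m) (κ : ℝ) :
    ContDiffOn ℝ ∞ (regSol m κ) (Set.Ioi (-1)) := by
  unfold regSol
  refine contDiffOn_const.add (contDiffOn_const.div (by fun_prop) (fun t ht => ?_))
  exact (one_add_pow_pos_of_odd hm ht).ne'

lemma hasDerivAt_regSol (m : ℕ) (κ : ℝ) {t : ℝ} (ht : 0 ≤ t) :
    HasDerivAt (regSol m κ) (regSolD m t) t := by
  have hx : (1 + t ^ m) ≠ 0 := by positivity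
  have h1 : HasDerivAt (fun t : ℝ => 1 + t ^ m) (m * t ^ (m - 1)) t :=
    (hasDerivAt_pow m t).const_add 1
  refine (((hasDerivAt_const t (2 * m : ℝ)).div h1 hx).const_add (κ - m)).congr_deriv ?_
  simp [regSolD]

lemma hasDerivAt_regSolD (m : ℕ) {t : ℝ} (ht : 0 ≤ t) :
    HasDerivAt (regSolD m) (regSolDD m t) t := by
  have hx : (1 + t ^ m) ≠ 0 := by positivity
  have h1 : HasDerivAt (fun t : ℝ => 1 + t ^ m) (m * t ^ (m - 1)) t :=
    (hasDerivAt_pow m t).const_add 1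
  have h2 := ((hasDerivAt_pow (m - 1) t).const_mul (m : ℝ)).const_mul (-(2 * m : ℝ))
  refine (h2.div (h1.pow 2) (pow_ne_zero 2 hx)).congr_deriv ?_
  simp only [regSolDD, Pi.pow_apply]
  field_simp
  push_cast
  ring

lemma regSol_ode {m : ℕ} (hm : 1 ≤ m) (κ : ℝ) {t : ℝ} (ht : 0 ≤ t) :
    4 * (t * regSolDD m t + (κ + 1) * regSolD m t) + radialPotential m t * regSol m κ t = 0 := by
  obtain ⟨n, rfl⟩ : ∃ n, m = n + 1 := ⟨m - 1, by omega⟩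
  have hx : (1 + t ^ (n + 1)) ≠ 0 := by positivity
  have hn : t * ((n : ℝ) * t ^ (n - 1)) = n * t ^ n := by
    rcases n with _ | n
    · simp
    · simp [pow_succ]; ring
  simp only [regSolDD, regSolD, radialPotential, regSol, Nat.add_sub_cancel]
  have e : t * (-(2 * ((n + 1 : ℕ) : ℝ)) * (((n + 1 : ℕ) : ℝ) * ((n : ℝ) * t ^ (n - 1))) /
      (1 + t ^ (n + 1)) ^ 2 + 4 * ((n + 1 : ℕ) : ℝ) * (((n + 1 : ℕ) : ℝ) * t ^ n) ^ 2 /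
      (1 + t ^ (n + 1)) ^ 3) = -(2 * ((n + 1 : ℕ) : ℝ)) * (((n + 1 : ℕ) : ℝ) * (n * t ^ n)) /
      (1 + t ^ (n + 1)) ^ 2 + 4 * ((n + 1 : ℕ) : ℝ) * ((n + 1 : ℕ) : ℝ) ^ 2 * t ^ n * t ^ (n + 1) /
      (1 + t ^ (n + 1)) ^ 3 := by
    rw [← hn]; ring
  rw [e]
  field_simp
  push_cast
  ring

/-- A test function on the half-line `(0, ∞)`: smooth, and supported in some `[a, R]`, `a > 0`. -/
def IsHalfLineTest (u : ℝ → ℝ) : Prop :=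
  ContDiff ℝ ∞ u ∧ ∃ a R : ℝ, 0 < a ∧ (∀ t ≤ a, u t = 0) ∧ ∀ t ≥ R, u t = 0

lemma contDiff_mul_of_eq_zero {f u : ℝ → ℝ} {a : ℝ} (hf : ContDiffOn ℝ ∞ f (Set.Ioi 0))
    (hu : ContDiff ℝ ∞ u) (ha : 0 < a) (hua : ∀ t ≤ a, u t = 0) :
    ContDiff ℝ ∞ (fun t => f t * u t) := by
  rw [contDiff_iff_contDiffAt]
  intro t
  rcases lt_or_ge 0 t with h | h
  · exact (hf.contDiffAt (Ioi_mem_nhds h)).mul hu.contDiffAt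
  · refine (contDiffAt_const (c := (0 : ℝ))).congr_of_eventuallyEq ?_
    filter_upwards [Iio_mem_nhds (h.trans_lt ha)] with s hs
    rw [hua s (le_of_lt hs), mul_zero]

lemma hasDerivAt_tail {f : ℝ → ℝ} (hf : Continuous f) (R t : ℝ) :
    HasDerivAt (fun t => ∫ s in t..R, f s) (-f t) t :=
  intervalIntegral.integral_hasDerivAt_left (hf.intervalIntegrable _ _)
    hf.stronglyMeasurable.stronglyMeasurableAtFilter hf.continuousAt

lemma contDiff_tail {f : ℝ → ℝ} (hf : ContDiff ℝ ∞ f) (R : ℝ) :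
    ContDiff ℝ ∞ (fun t => ∫ s in t..R, f s) := by
  rw [contDiff_infty_iff_deriv]
  refine ⟨fun t => (hasDerivAt_tail hf.continuous R t).differentiableAt, ?_⟩
  have : deriv (fun t => ∫ s in t..R, f s) = fun t => - f t :=
    funext fun t => (hasDerivAt_tail hf.continuous R t).deriv
  rw [this]
  exact hf.neg

lemma tail_eq_zero_of_le {f : ℝ → ℝ} {a R : ℝ} (h1 : ∀ t ≤ a, f t = 0) (h2 : ∀ t ≥ R, f t = 0)
    (h0 : ∫ t, f t = 0) {t : ℝ} (ht : t ≤ a) : ∫ s in t..R, f s = 0 := by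
  rw [intervalIntegral.integral_eq_integral_of_support_subset, h0]
  intro s hs
  constructor
  · by_contra h; exact hs (h1 s ((not_lt.1 h).trans ht))
  · by_contra h; exact hs (h2 s (not_le.1 h).le)

lemma tail_eq_zero_of_ge {f : ℝ → ℝ} {R : ℝ} (h2 : ∀ t ≥ R, f t = 0) {t : ℝ} (ht : R ≤ t) :
    ∫ s in t..R, f s = 0 := by
  rw [intervalIntegral.integral_symm, neg_eq_zero]
  refine intervalIntegral.integral_zero_ae (Filter.Eventually.of_forall fun s hs => ?_)
  rw [Set.uIoc_of_le ht] at hs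
  exact h2 s hs.1.le

/-- Variation of constants. Given a solution `G` regular at the origin and a second solution `H`, the
function `G ∫_t^∞ H w u - H ∫_t^∞ G w u`, with `w = t^k / c`, solves the radial equation with right
hand side `u` and vanishes for large `t`. Orthogonality of `u` to `t^k G` makes it a multiple of `G`
near the origin, so it is smooth there and is an admissible radial factor. -/
lemma exists_radialOp_eq {m k : ℕ} {G G₁ G₂ H H₁ H₂ : ℝ → ℝ} {c : ℝ}
    (hG : ContDiffOn ℝ ∞ G (Set.Ioi (-1))) (hH : ContDiffOn ℝ ∞ H (Set.Ioi 0))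
    (hG₁ : ∀ t, 0 ≤ t → HasDerivAt G (G₁ t) t) (hG₂ : ∀ t, 0 ≤ t → HasDerivAt G₁ (G₂ t) t)
    (hH₁ : ∀ t, 0 < t → HasDerivAt H (H₁ t) t) (hH₂ : ∀ t, 0 < t → HasDerivAt H₁ (H₂ t) t)
    (oG : ∀ t, 0 ≤ t → radialOp m k G G₁ G₂ t = 0)
    (oH : ∀ t, 0 < t → radialOp m k H H₁ H₂ t = 0)
    (hc : c ≠ 0) (hW : ∀ t, 0 < t → 4 * t ^ (k + 1) * (G t * H₁ t - G₁ t * H t) = c)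
    {u : ℝ → ℝ} {a R : ℝ} (hu : ContDiff ℝ ∞ u) (ha : 0 < a) (hua : ∀ t ≤ a, u t = 0)
    (huR : ∀ t ≥ R, u t = 0) (h0 : ∫ t, t ^ k * G t * u t = 0) :
    ∃ h h₁ h₂ : ℝ → ℝ, ContDiffOn ℝ ∞ h (Set.Ioi (-1)) ∧
      (∀ t, 0 ≤ t → HasDerivAt h (h₁ t) t) ∧ (∀ t, 0 ≤ t → HasDerivAt h₁ (h₂ t) t) ∧
      (∀ t ≥ R, h t = 0) ∧ ∀ t, 0 ≤ t → radialOp m k h h₁ h₂ t = u t := by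
  have hG0 : ContDiffOn ℝ ∞ G (Set.Ioi 0) := hG.mono (Set.Ioi_subset_Ioi (by norm_num))
  set f₁ : ℝ → ℝ := fun t => (t ^ k / c * H t) * u t with hf₁
  set f₂ : ℝ → ℝ := fun t => (t ^ k / c * G t) * u t with hf₂
  have cw : ContDiffOn ℝ ∞ (fun t : ℝ => t ^ k / c) (Set.Ioi 0) := by fun_prop
  have cf₁ : ContDiff ℝ ∞ f₁ := contDiff_mul_of_eq_zero (cw.mul hH) hu ha hua
  have cf₂ : ContDiff ℝ ∞ f₂ := contDiff_mul_of_eq_zero (cw.mul hG0) hu ha hua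
  set P : ℝ → ℝ := fun t => ∫ s in t..R, f₁ s with hP
  set Q : ℝ → ℝ := fun t => ∫ s in t..R, f₂ s with hQ
  have dP : ∀ t, HasDerivAt P (-f₁ t) t := hasDerivAt_tail cf₁.continuous R
  have dQ : ∀ t, HasDerivAt Q (-f₂ t) t := hasDerivAt_tail cf₂.continuous R
  have f₁a : ∀ t ≤ a, f₁ t = 0 := fun t ht => by simp [hf₁, hua t ht]
  have f₂a : ∀ t ≤ a, f₂ t = 0 := fun t ht => by simp [hf₂, hua t ht]
  have Qa : ∀ t ≤ a, Q t = 0 := fun t ht => by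
    refine tail_eq_zero_of_le f₂a (fun t ht => by simp [hf₂, huR t ht]) ?_ ht
    have : f₂ = fun t => c⁻¹ * (t ^ k * G t * u t) := by
      funext t; simp only [hf₂]; field_simp
    rw [this, integral_const_mul, h0, mul_zero]
  have PR : ∀ t ≥ R, P t = 0 := fun t ht =>
    tail_eq_zero_of_ge (fun t ht => by simp [hf₁, huR t ht]) ht
  have QR : ∀ t ≥ R, Q t = 0 := fun t ht =>
    tail_eq_zero_of_ge (fun t ht => by simp [hf₂, huR t ht]) ht
  refine ⟨fun t => G t * P t - H t * Q t, fun t => G₁ t * P t - H₁ t * Q t,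
    fun t => G₂ t * P t - H₂ t * Q t + (H₁ t * f₂ t - G₁ t * f₁ t), ?_, ?_, ?_, ?_, ?_⟩
  · exact (hG.mul (contDiff_tail cf₁ R).contDiffOn).sub
      (contDiff_mul_of_eq_zero hH (contDiff_tail cf₂ R) ha Qa).contDiffOn
  · intro t ht
    rcases lt_or_ge 0 t with h | h
    · refine (((hG₁ t ht).mul (dP t)).sub ((hH₁ t h).mul (dQ t))).congr_deriv ?_
      simp only [hf₁, hf₂]; ring
    · have hta : t < a := h.trans_lt ha
      refine (((hG₁ t ht).mul (dP t)).congr_of_eventuallyEq ?_).congr_deriv ?_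
      · filter_upwards [Iio_mem_nhds hta] with s hs
        simp [Qa s (le_of_lt hs)]
      · simp [Qa t hta.le, f₁a t hta.le]
  · intro t ht
    rcases lt_or_ge 0 t with h | h
    · refine (((hG₂ t ht).mul (dP t)).sub ((hH₂ t h).mul (dQ t))).congr_deriv ?_
      ring
    · have hta : t < a := h.trans_lt ha
      refine (((hG₂ t ht).mul (dP t)).congr_of_eventuallyEq ?_).congr_deriv ?_
      · filter_upwards [Iio_mem_nhds hta] with s hs
        simp [Qa s (le_of_lt hs)]
      · simp [Qa t hta.le, f₁a t hta.le, f₂a t hta.le]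
  · intro t ht
    simp [PR t ht, QR t ht]
  · intro t ht
    have e : radialOp m k (fun t => G t * P t - H t * Q t) (fun t => G₁ t * P t - H₁ t * Q t)
        (fun t => G₂ t * P t - H₂ t * Q t + (H₁ t * f₂ t - G₁ t * f₁ t)) t =
        radialOp m k G G₁ G₂ t * P t - radialOp m k H H₁ H₂ t * Q t +
        (4 * t ^ (k + 1) * (G t * H₁ t - G₁ t * H t)) / c * u t := by
      simp only [radialOp, hf₁, hf₂]; ring
    rw [e, oG t ht]
    rcases lt_or_ge a t with h | h
    · rw [oH t (ha.trans h), hW t (ha.trans h), div_self hc]; ring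
    · rw [Qa t h, hua t h]; ring

lemma mode_congr {f g : ℝ → ℝ} (h : ∀ t, 0 ≤ t → f t = g t) (k : ℕ) : mode f k = mode g k := by
  funext y; simp [mode, h _ (sq_nonneg ‖y‖)]

lemma integral_mode_eq_zero_of_orthogonal {m : ℕ} (hm : Odd m) {φ : Plane → ℝ}
    (hφ : SolvesLinearizedLiouville (2 * m) φ) {k : ℕ} (hk : k ≠ m) {u : ℝ → ℝ}
    (hu : IsHalfLineTest u) (h0 : ∫ t, t ^ k * regSol m k t * u t = 0) :
    ∫ y, (φ y : ℂ) * mode u k y = 0 := by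
  obtain ⟨hu, a, R, ha, hua, huR⟩ := hu
  have hm1 : 1 ≤ m := hm.pos
  have hIoi : ContDiffOn ℝ ∞ (regSol m (-k)) (Set.Ioi 0) :=
    (contDiffOn_regSol hm _).mono (Set.Ioi_subset_Ioi (by norm_num))
  have oG : ∀ t, 0 ≤ t → radialOp m k (regSol m k) (regSolD m) (regSolDD m) t = 0 :=
    fun t ht => regSol_ode hm1 k ht
  suffices hs : ∃ h h₁ h₂ : ℝ → ℝ, ContDiffOn ℝ ∞ h (Set.Ioi (-1)) ∧
      (∀ t, 0 ≤ t → HasDerivAt h (h₁ t) t) ∧ (∀ t, 0 ≤ t → HasDerivAt h₁ (h₂ t) t) ∧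
      (∀ t ≥ R, h t = 0) ∧ ∀ t, 0 ≤ t → radialOp m k h h₁ h₂ t = u t by
    obtain ⟨h, h₁, h₂, hh, hd, hd₁, hR, he⟩ := hs
    rw [← mode_congr he, integral_mode_radialOp hm1 hφ k hh hd hd₁ hR]
  rcases Nat.eq_zero_or_pos k with rfl | hk0
  · -- the second solution of frequency zero is `1 + (log t / 2) G`
    simp only [Nat.cast_zero, neg_zero] at *
    refine exists_radialOp_eq (H := fun t => 1 + 1 / 2 * (Real.log t * regSol m 0 t))
      (H₁ := fun t => 1 / 2 * (t⁻¹ * regSol m 0 t + Real.log t * regSolD m t))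
      (H₂ := fun t => 1 / 2 * (-(t ^ 2)⁻¹ * regSol m 0 t + t⁻¹ * regSolD m t +
        (t⁻¹ * regSolD m t + Real.log t * regSolDD m t))) (c := 2 * m ^ 2)
      (contDiffOn_regSol hm _) ?_ (fun t ht => hasDerivAt_regSol m _ ht)
      (fun t ht => hasDerivAt_regSolD m ht) ?_ ?_ oG ?_ (by positivity) ?_ hu ha hua huR h0
    · refine contDiffOn_const.add (contDiffOn_const.mul (ContDiffOn.mul ?_ hIoi))
      exact Real.contDiffOn_log.mono (fun t ht => (ne_of_gt ht : t ≠ 0))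
    · intro t ht
      exact (((Real.hasDerivAt_log ht.ne').mul (hasDerivAt_regSol m _ ht.le)).const_mul
        _).const_add 1
    · intro t ht
      exact (((hasDerivAt_inv ht.ne').mul (hasDerivAt_regSol m _ ht.le)).add
        ((Real.hasDerivAt_log ht.ne').mul (hasDerivAt_regSolD m ht.le))).const_mul _
    · intro t ht
      have o := regSol_ode hm1 0 ht.le
      have e : 4 * regSolD m t + radialPotential m t = 0 := by
        simp only [regSolD, radialPotential]; ring
      simp only [radialOp, Nat.cast_zero]
      field_simp
      linear_combination t * (Real.log t * o + 2 * e)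
    · intro t ht
      obtain ⟨n, rfl⟩ : ∃ n, m = n + 1 := ⟨m - 1, by omega⟩
      have hx : (1 + t ^ (n + 1)) ≠ 0 := by positivity
      simp only [regSol, regSolD, Nat.add_sub_cancel]
      field_simp
      ring
  · -- the second solution of frequency `k` is `t ^ (-k)` times `regSol m (-k)`
    have hkR : (k : ℝ) ≠ 0 := by exact_mod_cast hk0.ne'
    have hz : ∀ t : ℝ, 0 < t → t ^ (-(k : ℤ)) ≠ 0 := fun t ht => (zpow_pos ht _).ne'
    refine exists_radialOp_eq (H := fun t => t ^ (-(k : ℤ)) * regSol m (-k) t)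
      (H₁ := fun t => t ^ (-(k : ℤ)) * (-k / t) * regSol m (-k) t +
        t ^ (-(k : ℤ)) * regSolD m t)
      (H₂ := fun t => t ^ (-(k : ℤ)) * (k * (k + 1) / t ^ 2) * regSol m (-k) t +
        2 * (t ^ (-(k : ℤ)) * (-k / t) * regSolD m t) + t ^ (-(k : ℤ)) * regSolDD m t)
      (c := 4 * k * (k ^ 2 - m ^ 2))
      (contDiffOn_regSol hm _) ?_ (fun t ht => hasDerivAt_regSol m _ ht)
      (fun t ht => hasDerivAt_regSolD m ht) ?_ ?_ oG ?_ ?_ ?_ hu ha hua huR h0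
    · refine ContDiffOn.mul ?_ hIoi
      simp only [zpow_neg, zpow_natCast]
      exact (contDiffOn_id.pow k).inv (fun t ht => pow_ne_zero k (ne_of_gt ht))
    · intro t ht
      have hzp : HasDerivAt (fun t : ℝ => t ^ (-(k : ℤ))) (t ^ (-(k : ℤ)) * (-k / t)) t := by
        refine (hasDerivAt_zpow (-(k : ℤ)) t (Or.inl ht.ne')).congr_deriv ?_
        rw [zpow_sub_one₀ ht.ne']; push_cast; ring
      exact hzp.mul (hasDerivAt_regSol m _ ht.le)
    · intro t ht
      have hzp : HasDerivAt (fun t : ℝ => t ^ (-(k : ℤ))) (t ^ (-(k : ℤ)) * (-k / t)) t := by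
        refine (hasDerivAt_zpow (-(k : ℤ)) t (Or.inl ht.ne')).congr_deriv ?_
        rw [zpow_sub_one₀ ht.ne']; push_cast; ring
      have hkt : HasDerivAt (fun t : ℝ => -k / t) (k / t ^ 2) t := by
        refine ((hasDerivAt_inv ht.ne').const_mul (-k : ℝ)).congr_deriv ?_
        ring
      refine (((hzp.mul hkt).mul (hasDerivAt_regSol m _ ht.le)).add
        (hzp.mul (hasDerivAt_regSolD m ht.le))).congr_deriv ?_
      simp only [Pi.mul_apply]
      field_simp
      ring
    · intro t ht
      have o := regSol_ode hm1 (-k) ht.le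
      simp only [radialOp]
      have := ht.ne'
      have hz1 := hz t ht
      field_simp
      linear_combination t ^ (-(k : ℤ)) * t * o
    · have h1 : (k : ℝ) ^ 2 - m ^ 2 ≠ 0 := by
        rw [sub_ne_zero]
        intro h
        have : k ^ 2 = m ^ 2 := by exact_mod_cast h
        exact hk (Nat.pow_left_injective (n := 2) (by norm_num) this)
      positivity
    · intro t ht
      have hzk : t ^ k * t ^ (-(k : ℤ)) = 1 := by
        rw [zpow_neg, zpow_natCast]; exact mul_inv_cancel₀ (pow_pos ht k).ne'
      have e : 4 * t ^ (k + 1) * (regSol m k t * (t ^ (-(k : ℤ)) * (-k / t) * regSol m (-k) t +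
          t ^ (-(k : ℤ)) * regSolD m t) - regSolD m t * (t ^ (-(k : ℤ)) * regSol m (-k) t)) =
          4 * (t ^ k * t ^ (-(k : ℤ))) * (t * regSolD m t * (regSol m k t - regSol m (-k) t) -
          k * (t / t) * regSol m k t * regSol m (-k) t) := by ring
      rw [e, hzk, div_self ht.ne']
      obtain ⟨n, rfl⟩ : ∃ n, m = n + 1 := ⟨m - 1, by omega⟩
      have hx : (1 + t ^ (n + 1)) ≠ 0 := by positivity
      simp only [regSol, regSolD, Nat.add_sub_cancel]
      field_simp
      ring

/-! ### The angular modes of a solution -/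

lemma IsHalfLineTest.contDiff {u : ℝ → ℝ} (hu : IsHalfLineTest u) : ContDiff ℝ ∞ u := hu.1

lemma IsHalfLineTest.mul_contDiffOn {u f : ℝ → ℝ} (hu : IsHalfLineTest u)
    (hf : ContDiffOn ℝ ∞ f (Set.Ioi 0)) : IsHalfLineTest (fun t => f t * u t) := by
  obtain ⟨h, a, R, ha, h1, h2⟩ := hu
  exact ⟨contDiff_mul_of_eq_zero hf h ha h1, a, R, ha, fun t ht => by simp [h1 t ht],
    fun t ht => by simp [h2 t ht]⟩

lemma IsHalfLineTest.sub_const_mul {u v : ℝ → ℝ} (hu : IsHalfLineTest u) (hv : IsHalfLineTest v)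
    (c : ℝ) : IsHalfLineTest (fun t => u t - c * v t) := by
  obtain ⟨h, a, R, ha, h1, h2⟩ := hu
  obtain ⟨h', a', R', ha', h1', h2'⟩ := hv
  exact ⟨h.sub (contDiff_const.mul h'), min a a', max R R', lt_min ha ha',
    fun t ht => by simp [h1 t (ht.trans (min_le_left _ _)), h1' t (ht.trans (min_le_right _ _))],
    fun t ht => by simp [h2 t ((le_max_left _ _).trans ht), h2' t ((le_max_right _ _).trans ht)]⟩

lemma IsHalfLineTest.integrable {u : ℝ → ℝ} (hu : IsHalfLineTest u) : Integrable u := by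
  obtain ⟨h, a, R, -, h1, h2⟩ := hu
  refine h.continuous.integrable_of_hasCompactSupport
    (HasCompactSupport.intro (isCompact_Icc (a := a) (b := R)) fun t ht => ?_)
  by_cases hta : a ≤ t
  · exact h2 t (not_le.1 fun h' => ht ⟨hta, h'⟩).le
  · exact h1 t (not_le.1 hta).le

lemma IsHalfLineTest.integrable_mode {u : ℝ → ℝ} (hu : IsHalfLineTest u) {φ : Plane → ℝ}
    (hφ : LocallyIntegrable φ volume) (k : ℕ) :
    Integrable (fun y => (φ y : ℂ) * mode u k y) := by
  obtain ⟨h, a, R, -, -, h2⟩ := hu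
  exact integrable_ofReal_mul hφ (contDiff_mode k h.contDiffOn).continuous
    (hasCompactSupport_mode k h2)

lemma isHalfLineTest_contDiffBump {c : ℝ} (b : ContDiffBump c) (h : b.rOut < c) :
    IsHalfLineTest b := by
  refine ⟨b.contDiff, c - b.rOut, c + b.rOut, by linarith, fun t ht => ?_, fun t ht => ?_⟩ <;>
    refine b.zero_of_le_dist ?_ <;> rw [Real.dist_eq, le_abs]
  · right; linarith
  · left; linarith

lemma exists_halfLineTest_unit : ∃ u : ℝ → ℝ, IsHalfLineTest u ∧ (∀ t, 0 ≤ u t) ∧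
    (∀ t, u t ≤ 1) ∧ (∀ t ≤ 1 / 4, u t = 0) ∧ (∀ t ≥ 3 / 4, u t = 0) ∧ 0 < ∫ t, u t := by
  let b : ContDiffBump (1 / 2 : ℝ) := ⟨1 / 8, 1 / 4, by norm_num, by norm_num⟩
  refine ⟨b, isHalfLineTest_contDiffBump b (by norm_num [b]), fun t => b.nonneg, fun t => b.le_one,
    fun t ht => b.zero_of_le_dist ?_, fun t ht => b.zero_of_le_dist ?_, b.integral_pos⟩ <;>
    rw [Real.dist_eq, le_abs]
  · right; simp only [b]; linarith
  · left; simp only [b]; linarith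

lemma isHalfLineTest_pow_mul_regSol_mul {m : ℕ} (hm : Odd m) (k : ℕ) {u : ℝ → ℝ}
    (hu : IsHalfLineTest u) : IsHalfLineTest (fun t => t ^ k * regSol m k t * u t) :=
  hu.mul_contDiffOn ((contDiffOn_id.pow k).mul
    ((contDiffOn_regSol hm k).mono (Set.Ioi_subset_Ioi (by norm_num))))

/-- The pairing of a solution with the modes of a given frequency is a multiple of the pairing with
the regular radial solution: the kernel of the latter is contained in that of the former. -/
lemma exists_integral_mode_eq {m : ℕ} (hm : Odd m) {φ : Plane → ℝ}
    (hφ : SolvesLinearizedLiouville (2 * m) φ) {k : ℕ} (hk : k ≠ m) :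
    ∃ c : ℂ, ∀ u, IsHalfLineTest u →
      ∫ y, (φ y : ℂ) * mode u k y = c * ((∫ t, t ^ k * regSol m k t * u t : ℝ) : ℂ) := by
  obtain ⟨u₀, hu₀, h0, -, hl, hr, hI⟩ := exists_halfLineTest_unit
  set I₀ : ℝ := ∫ t, t ^ k * regSol m k t * u₀ t with hI₀
  have hm1 : (1 : ℝ) ≤ m := by exact_mod_cast hm.pos
  -- on `(1/4, 3/4)` the regular solution is at least `k + m / 7`
  have hpos : 0 < I₀ := by
    have hle : ∫ t, (1 / 4 : ℝ) ^ k * (1 / 7) * u₀ t ≤ I₀ := by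
      refine integral_mono (hu₀.integrable.const_mul _)
        (isHalfLineTest_pow_mul_regSol_mul hm k hu₀).integrable (fun t => ?_)
      rcases le_or_gt t (1 / 4) with h | h
      · simp [hl t h]
      rcases le_or_gt (3 / 4) t with h' | h'
      · simp [hr t h']
      have hx : t ^ m ≤ 3 / 4 :=
        (pow_le_of_le_one (by linarith) (by linarith) hm.pos.ne').trans h'.le
      have hx0 : 0 < t ^ m := pow_pos (by linarith) m
      have hS : 1 / 7 ≤ regSol m k t := by
        have h8 : 8 / 7 * (m : ℝ) ≤ 2 * m / (1 + t ^ m) := by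
          rw [le_div_iff₀ (by positivity)]
          nlinarith
        have : (0 : ℝ) ≤ k := k.cast_nonneg
        simp only [regSol]
        linarith
      have := h0 t
      have ht : 0 ≤ t := by linarith
      dsimp only
      gcongr
    refine lt_of_lt_of_le ?_ hle
    rw [integral_const_mul]
    positivity
  refine ⟨(∫ y, (φ y : ℂ) * mode u₀ k y) / I₀, fun u hu => ?_⟩
  set I : ℝ := ∫ t, t ^ k * regSol m k t * u t with hIdef
  have h1 : ∫ t, t ^ k * regSol m k t * (u t - I / I₀ * u₀ t) = 0 := by
    have e : ∀ t, t ^ k * regSol m k t * (u t - I / I₀ * u₀ t) =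
        t ^ k * regSol m k t * u t - I / I₀ * (t ^ k * regSol m k t * u₀ t) := fun t => by ring
    simp only [e]
    rw [integral_sub (isHalfLineTest_pow_mul_regSol_mul hm k hu).integrable
      ((isHalfLineTest_pow_mul_regSol_mul hm k hu₀).integrable.const_mul _), integral_const_mul,
      ← hIdef, ← hI₀, div_mul_cancel₀ _ hpos.ne', sub_self]
  have h2 := integral_mode_eq_zero_of_orthogonal hm hφ hk (hu.sub_const_mul hu₀ (I / I₀)) h1
  have e2 : ∀ y, (φ y : ℂ) * mode (fun t => u t - I / I₀ * u₀ t) k y =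
      (φ y : ℂ) * mode u k y - ((I / I₀ : ℝ) : ℂ) * ((φ y : ℂ) * mode u₀ k y) := fun y => by
    simp only [mode]; push_cast; ring
  simp only [e2] at h2
  rw [integral_sub (hu.integrable_mode hφ.1 k) ((hu₀.integrable_mode hφ.1 k).const_mul _),
    integral_const_mul, sub_eq_zero] at h2
  rw [h2]
  push_cast
  ring

/-- Finite energy rules out the frequencies `k ≠ 0, m`: there the regular radial solution, times
`t ^ k`, grows at infinity faster than a square integrable gradient allows. This is tested with the
cutoffs `u(t / S²)` as `S → ∞`. -/
lemma integral_mode_eq_zero_of_energy {m : ℕ} (hm : Odd m) {φ : Plane → ℝ}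
    (hφ : SolvesLinearizedLiouville (2 * m) φ) (hE : HasFiniteDirichletEnergy φ)
    {k : ℕ} (hk0 : k ≠ 0) (hk : k ≠ m) {u : ℝ → ℝ} (hu : IsHalfLineTest u) :
    ∫ y, (φ y : ℂ) * mode u k y = 0 := by
  obtain ⟨c, hc⟩ := exists_integral_mode_eq hm hφ hk
  suffices hc0 : c = 0 by rw [hc u hu, hc0, zero_mul]
  obtain ⟨G, hG, hL⟩ := hE
  obtain ⟨u₀, hu₀, h0, hone, hl, hr, hI⟩ := exists_halfLineTest_unit
  set E : ℝ := ∫ y, ‖G y‖ ^ 2 with hEdef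
  have hm1 : (1 : ℝ) ≤ m := by exact_mod_cast hm.pos
  have hkm : (1 : ℝ) ≤ |(k : ℝ) - m| := by
    have : (1 : ℤ) ≤ |(k : ℤ) - m| := Int.one_le_abs (sub_ne_zero.2 (by exact_mod_cast hk))
    exact_mod_cast this
  set I₀ : ℝ := ∫ t, u₀ t with hI₀
  by_contra hne
  have hcpos : 0 < ‖c‖ := norm_pos_iff.2 hne
  have hkpos : (1 : ℝ) ≤ k := by exact_mod_cast Nat.one_le_iff_ne_zero.2 hk0
  set δ : ℝ := (1 / 4) ^ k * (1 / 2) * I₀ with hδ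
  have hδpos : 0 < δ := by positivity
  have hmain : ∀ S : ℝ, 4 * m ≤ S → ‖c‖ * δ * S ≤ (E + Real.pi) * |(k : ℝ) - m| := by
    intro S hS
    have hS1 : 1 ≤ S := by linarith
    have hSpos : 0 < S := by linarith
    have hS2 : 0 < S ^ 2 := by positivity
    have hSS : S ≤ S ^ 2 := by nlinarith
    set q : ℝ → ℝ := fun t => u₀ (t / S ^ 2) with hq
    have hqC : ContDiff ℝ ∞ q := hu₀.contDiff.comp (contDiff_id.div_const _)
    have hq1 : ∀ t, |q t| ≤ 1 := fun t => by rw [abs_of_nonneg (h0 _)]; exact hone _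
    have hql : ∀ t ≤ S ^ 2 / 4, q t = 0 := fun t ht => hl _ (by
      rw [div_le_iff₀ hS2]; linarith)
    have hqr : ∀ t ≥ S ^ 2, q t = 0 := fun t ht => hr _ (by
      rw [ge_iff_le, le_div_iff₀ hS2]; linarith)
    have hqT : IsHalfLineTest q := ⟨hqC, S ^ 2 / 4, S ^ 2, by positivity, hql, hqr⟩
    -- this weight makes both terms of the bound of order `S ^ (k + 2)`
    have hup := norm_integral_mode_le hG hL k hqC hq1 hSpos hqr (lam := S ^ (k + 2))
      (by positivity)
    have hdiv : Real.pi * S ^ (2 * k + 4) / S ^ (k + 2) = Real.pi * S ^ (k + 2) := by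
      rw [show 2 * k + 4 = (k + 2) + (k + 2) by ring, pow_add]; field_simp
    rw [hdiv, hc q hqT, norm_mul, Complex.norm_real, Real.norm_eq_abs, ← hEdef] at hup
    -- on the support of `q`, `t ≥ S² / 4 ≥ 4m` keeps `regSol` within `1 / 2` of its limit `k - m`
    have hlow : δ * S ^ (2 * k + 2) ≤
        |(k : ℝ) - m| * |∫ t, t ^ k * regSol m k t * q t| := by
      rw [← abs_mul, ← integral_const_mul]
      refine le_trans ?_ (le_abs_self _)
      have e : δ * S ^ (2 * k + 2) = ∫ t, (S ^ 2 / 4) ^ k * (1 / 2) * q t := by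
        rw [integral_const_mul]
        have := Measure.integral_comp_div u₀ (S ^ 2)
        rw [hq, this, abs_of_pos hS2, smul_eq_mul, hδ, div_pow, div_pow]
        ring
      rw [e]
      refine integral_mono (hqT.integrable.const_mul _)
        ((isHalfLineTest_pow_mul_regSol_mul hm k hqT).integrable.const_mul _) (fun t => ?_)
      dsimp only
      rcases le_or_gt t (S ^ 2 / 4) with h | h
      · simp [hql t h]
      have hq0 : 0 ≤ q t := h0 _
      have htm : (m : ℝ) ≤ t := by nlinarith
      have ht1 : 1 ≤ t := by linarith
      have hS' : 1 / 2 ≤ ((k : ℝ) - m) * regSol m k t := by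
        have hx : 4 * (m : ℝ) ≤ 1 + t ^ m := by
          have h1 : t ≤ t ^ m := le_self_pow₀ ht1 hm.pos.ne'
          nlinarith
        have hy : 2 * (m : ℝ) / (1 + t ^ m) ≤ 1 / 2 := by
          rw [div_le_iff₀ (by linarith)]; linarith
        have hy0 : 0 ≤ 2 * (m : ℝ) / (1 + t ^ m) := div_nonneg (by linarith) (by linarith)
        simp only [regSol]
        rcases le_abs.1 hkm with h1 | h1 <;> nlinarith
      calc (S ^ 2 / 4) ^ k * (1 / 2) * q t
          ≤ t ^ k * (((k : ℝ) - m) * regSol m k t) * q t := by gcongr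
        _ = _ := by ring
    have hfin : ‖c‖ * δ * S ^ (2 * k + 2) ≤
        (E + Real.pi) * |(k : ℝ) - m| * S ^ (k + 2) := by
      calc ‖c‖ * δ * S ^ (2 * k + 2) = ‖c‖ * (δ * S ^ (2 * k + 2)) := by ring
        _ ≤ ‖c‖ * (|(k : ℝ) - m| * |∫ t, t ^ k * regSol m k t * q t|) := by gcongr
        _ = |(k : ℝ) - m| * (1 * (‖c‖ * |∫ t, t ^ k * regSol m k t * q t|)) := by ring
        _ ≤ |(k : ℝ) - m| * (k * (‖c‖ * |∫ t, t ^ k * regSol m k t * q t|)) := by gcongr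
        _ ≤ |(k : ℝ) - m| * (S ^ (k + 2) * E + Real.pi * S ^ (k + 2)) := by gcongr
        _ = _ := by ring
    have hpow : S ^ (2 * k + 2) = S ^ k * S ^ (k + 2) := by rw [← pow_add]; ring_nf
    rw [hpow, ← mul_assoc] at hfin
    have h3 := le_of_mul_le_mul_right hfin (by positivity)
    refine le_trans ?_ h3
    gcongr
    exact le_self_pow₀ hS1 hk0
  set A : ℝ := (E + Real.pi) * |(k : ℝ) - m| with hA
  have h4 := hmain (max (4 * m) (A / (‖c‖ * δ) + 1)) (le_max_left _ _)
  have h5 : ‖c‖ * δ * (A / (‖c‖ * δ) + 1) ≤ A :=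
    le_trans (by gcongr; exact le_max_right _ _) h4
  have h6 : ‖c‖ * δ * (A / (‖c‖ * δ) + 1) = A + ‖c‖ * δ := by field_simp
  have : 0 < ‖c‖ * δ := by positivity
  linarith

lemma integral_mode_eq_zero_of_even {φ : Plane → ℝ}
    (h : ∀ᵐ y ∂(volume : Measure Plane), φ y = φ (-y)) {k : ℕ} (hk : Odd k) (u : ℝ → ℝ) :
    ∫ y, (φ y : ℂ) * mode u k y = 0 := by
  have h1 := integral_neg_eq_self (fun y => (φ y : ℂ) * mode u k y) (volume : Measure Plane)
  have h2 : ∫ y, (φ (-y) : ℂ) * mode u k (-y) = - ∫ y, (φ y : ℂ) * mode u k y := by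
    rw [← integral_neg]
    refine integral_congr_ae ?_
    filter_upwards [h] with y hy
    simp [mode, hk.neg_pow, ← hy]
  rw [h2] at h1
  exact CharZero.eq_neg_self_iff.1 h1.symm

/-- A radial function is orthogonal to all modes of positive frequency, by rotation through the angle
`π / k`, under which the mode changes sign. -/
lemma integral_mode_eq_zero {k : ℕ} (hk : k ≠ 0) (g : ℝ → ℝ) : ∫ y, mode g k y = 0 := by
  set ζ : Circle := Circle.exp (Real.pi / k) with hζ
  set ρ : Plane ≃ₗᵢ[ℝ] Plane := (toC.trans (rotation ζ)).trans toC.symm with hρ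
  have hζk : (ζ : ℂ) ^ k = -1 := by
    rw [← Circle.coe_pow, hζ, ← Circle.exp_natCast_mul]
    have : (k : ℝ) * (Real.pi / k) = Real.pi := by
      have : (k : ℝ) ≠ 0 := by exact_mod_cast hk
      field_simp
    rw [this, Circle.coe_exp, Complex.exp_pi_mul_I]
  have hm : ∀ y, mode g k (ρ y) = - mode g k y := fun y => by
    have : toC (ρ y) = ζ * toC y := by simp [hρ, rotation_apply]
    simp only [mode, LinearIsometryEquiv.norm_map, this, mul_pow, hζk]
    ring
  have h1 := ρ.measurePreserving.integral_comp ρ.toHomeomorph.measurableEmbedding (mode g k)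
  simp only [hm, integral_neg] at h1
  exact CharZero.eq_neg_self_iff.1 h1.symm

lemma integral_comp_norm_sq (f : ℝ → ℝ) :
    ∫ y : Plane, f (‖y‖ ^ 2) = Real.pi * ∫ t in Set.Ioi 0, f t := by
  have h1 := integral_fun_norm_addHaar (volume : Measure Plane) (fun r => f (r ^ 2))
  have h2 := integral_comp_rpow_Ioi_of_pos (g := f) (p := 2) (by norm_num)
  rw [h1, ← h2, Measure.real, EuclideanSpace.volume_ball_fin_two]
  have e : ∀ x : ℝ, ((2 : ℝ) * x ^ ((2 : ℝ) - 1)) • f (x ^ (2 : ℝ)) = 2 * (x * f (x ^ 2)) := by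
    intro x
    rw [show (2 : ℝ) - 1 = 1 by norm_num, Real.rpow_one]
    norm_cast
    simp only [smul_eq_mul]; ring
  simp only [e, integral_const_mul]
  simp [Real.pi_pos.le]
  ring

/-! ### Completeness of the angular modes -/

lemma integral_mul_pow_mul_conj_pow_eq_zero {F : Plane → ℝ}
    (h : ∀ (k : ℕ) (u : ℝ → ℝ), IsHalfLineTest u → ∫ y, (F y : ℂ) * mode u k y = 0)
    {u : ℝ → ℝ} (hu : IsHalfLineTest u) (a b : ℕ) :
    ∫ y, (F y : ℂ) * mode u 0 y * (toC y ^ a * (starRingEnd ℂ) (toC y) ^ b) = 0 := by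
  wlog hab : b ≤ a generalizing a b with H
  · have h1 := congrArg (starRingEnd ℂ) (H b a (le_of_not_ge hab))
    rw [← integral_conj, map_zero] at h1
    rw [← h1]
    congr 1
    ext y
    simp only [mode, map_mul, map_pow, Complex.conj_ofReal, Complex.conj_conj, pow_zero, mul_one]
    ring
  obtain ⟨k, rfl⟩ := Nat.exists_eq_add_of_le hab
  have hv : IsHalfLineTest (fun t => t ^ b * u t) := hu.mul_contDiffOn (contDiffOn_id.pow b)
  rw [← h k _ hv]
  congr 1
  ext y
  have e : toC y * (starRingEnd ℂ) (toC y) = ((‖y‖ ^ 2 : ℝ) : ℂ) := by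
    rw [Complex.mul_conj, Complex.normSq_eq_norm_sq, LinearIsometryEquiv.norm_map]
  have e2 : toC y ^ (b + k) * (starRingEnd ℂ) (toC y) ^ b =
      ((‖y‖ ^ 2 : ℝ) : ℂ) ^ b * toC y ^ k := by
    rw [← e]; ring
  rw [e2]
  simp only [mode]
  push_cast
  ring

lemma integral_mul_polynomial_eq_zero {F : Plane → ℝ} (hF : LocallyIntegrable F volume)
    (h : ∀ (k : ℕ) (u : ℝ → ℝ), IsHalfLineTest u → ∫ y, (F y : ℂ) * mode u k y = 0)
    {u : ℝ → ℝ} (hu : IsHalfLineTest u) (P : MvPolynomial (Fin 2) ℂ) :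
    ∫ y, (F y : ℂ) * mode u 0 y *
      MvPolynomial.eval ![toC y, (starRingEnd ℂ) (toC y)] P = 0 := by
  have hint : ∀ a b : ℕ, Integrable (fun y => (F y : ℂ) * mode u 0 y *
      (toC y ^ a * (starRingEnd ℂ) (toC y) ^ b)) := fun a b => by
    obtain ⟨hc, -, R, -, -, h2⟩ := hu
    simp only [mul_assoc]
    refine integrable_ofReal_mul hF (g := fun y => mode u 0 y *
      (toC y ^ a * (starRingEnd ℂ) (toC y) ^ b)) ?_ (hasCompactSupport_mode 0 h2).mul_right
    refine (contDiff_mode 0 hc.contDiffOn).continuous.mul (Continuous.mul ?_ ?_)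
    · exact toC.continuous.pow a
    · exact (Complex.continuous_conj.comp toC.continuous).pow b
  have e : ∀ y, (F y : ℂ) * mode u 0 y *
      MvPolynomial.eval ![toC y, (starRingEnd ℂ) (toC y)] P =
      ∑ d ∈ P.support, P.coeff d * ((F y : ℂ) * mode u 0 y *
        (toC y ^ d 0 * (starRingEnd ℂ) (toC y) ^ d 1)) := fun y => by
    rw [MvPolynomial.eval_eq', Finset.mul_sum]
    refine Finset.sum_congr rfl fun d _ => ?_
    simp only [Fin.prod_univ_two, Matrix.cons_val_zero, Matrix.cons_val_one]
    ring
  simp only [e]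
  rw [integral_finsetSum _ fun d _ => (hint _ _).const_mul _]
  refine Finset.sum_eq_zero fun d _ => ?_
  rw [integral_const_mul, integral_mul_pow_mul_conj_pow_eq_zero h hu, mul_zero]

/-- Stone–Weierstrass on a compact subset of `ℂ`, with the approximants written as polynomials in `z`
and its conjugate. -/
lemma exists_mvPolynomial_near {K : Set ℂ} [CompactSpace K] (f : C(K, ℂ)) {ε : ℝ} (hε : 0 < ε) :
    ∃ P : MvPolynomial (Fin 2) ℂ, ∀ z : K,
      ‖f z - MvPolynomial.eval ![(z : ℂ), (starRingEnd ℂ) (z : ℂ)] P‖ ≤ ε := by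
  have htop : f ∈ (polynomialFunctions K).starClosure.topologicalClosure := by
    rw [polynomialFunctions.starClosure_topologicalClosure]; trivial
  rw [← SetLike.mem_coe, StarSubalgebra.topologicalClosure_coe, Metric.mem_closure_iff] at htop
  obtain ⟨g, hg, hfg⟩ := htop ε hε
  have hrep : ∃ P : MvPolynomial (Fin 2) ℂ, ∀ z : K,
      g z = MvPolynomial.eval ![(z : ℂ), (starRingEnd ℂ) (z : ℂ)] P := by
    rw [SetLike.mem_coe, polynomialFunctions.starClosure_eq_adjoin_X] at hg
    clear hfg
    induction hg using StarAlgebra.adjoin_induction with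
    | mem f hf =>
      rw [Set.mem_singleton_iff] at hf
      subst hf
      exact ⟨MvPolynomial.X 0, fun z => by simp⟩
    | algebraMap r => exact ⟨MvPolynomial.C r, fun z => by simp⟩
    | add f g _ _ hf hg =>
      obtain ⟨P, hP⟩ := hf
      obtain ⟨Q, hQ⟩ := hg
      exact ⟨P + Q, fun z => by simp [hP, hQ]⟩
    | mul f g _ _ hf hg =>
      obtain ⟨P, hP⟩ := hf
      obtain ⟨Q, hQ⟩ := hg
      exact ⟨P * Q, fun z => by simp [hP, hQ]⟩
    | star f _ hf =>
      obtain ⟨P, hP⟩ := hf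
      -- conjugation swaps the two variables and conjugates the coefficients
      refine ⟨MvPolynomial.map (starRingEnd ℂ) (MvPolynomial.rename (Equiv.swap 0 1) P),
        fun z => ?_⟩
      rw [ContinuousMap.star_apply, hP, MvPolynomial.eval_map, MvPolynomial.eval₂_rename,
        MvPolynomial.eval_eq', MvPolynomial.eval₂_eq']
      simp [Fin.prod_univ_two, mul_comm]
  obtain ⟨P, hP⟩ := hrep
  refine ⟨P, fun z => ?_⟩
  rw [← hP, ← dist_eq_norm]
  exact (ContinuousMap.dist_apply_le_dist z).trans hfg.le

lemma integral_mul_continuous_eq_zero {F : Plane → ℝ} (hF : LocallyIntegrable F volume)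
    (h : ∀ (k : ℕ) (u : ℝ → ℝ), IsHalfLineTest u → ∫ y, (F y : ℂ) * mode u k y = 0)
    {u : ℝ → ℝ} (hu : IsHalfLineTest u) {g : Plane → ℂ} (hg : Continuous g) :
    ∫ y, (F y : ℂ) * mode u 0 y * g y = 0 := by
  have hW : Integrable (fun y => (F y : ℂ) * mode u 0 y) := hu.integrable_mode hF 0
  obtain ⟨hc, -, R, -, -, h2⟩ := id hu
  have hvan : ∀ y : Plane, max R 1 < ‖y‖ → mode u 0 y = 0 := fun y hy => by
    have : u (‖y‖ ^ 2) = 0 := h2 _ (by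
      have h1 := (max_lt_iff.1 hy).1
      have h2 := (max_lt_iff.1 hy).2
      nlinarith)
    simp [mode, this]
  have hint : ∀ f : Plane → ℂ, Continuous f →
      Integrable (fun y => (F y : ℂ) * mode u 0 y * f y) := fun f hf => by
    simp only [mul_assoc]
    exact integrable_ofReal_mul hF (g := fun y => mode u 0 y * f y)
      ((contDiff_mode 0 hc.contDiffOn).continuous.mul hf) (hasCompactSupport_mode 0 h2).mul_right
  set K : Set ℂ := Metric.closedBall 0 (max R 1)
  have : CompactSpace K := isCompact_iff_compactSpace.1 (isCompact_closedBall _ _)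
  let f : C(K, ℂ) := ⟨fun z => g (toC.symm z), by fun_prop⟩
  set M : ℝ := ∫ y, ‖(F y : ℂ) * mode u 0 y‖ with hM
  have hM0 : 0 ≤ M := integral_nonneg fun _ => norm_nonneg _
  rw [← norm_le_zero_iff]
  refine le_of_forall_pos_le_add fun ε hε => ?_
  obtain ⟨P, hP⟩ := exists_mvPolynomial_near f (ε := ε / (M + 1)) (by positivity)
  have hPc : Continuous
      (fun y : Plane => MvPolynomial.eval ![toC y, (starRingEnd ℂ) (toC y)] P) := by
    have c1 : Continuous (fun y : Plane => ![toC y, (starRingEnd ℂ) (toC y)]) := by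
      refine continuous_pi fun i => ?_
      fin_cases i
      · exact toC.continuous
      · exact Complex.continuous_conj.comp toC.continuous
    exact (MvPolynomial.continuous_eval P).comp c1
  have e : ∫ y, (F y : ℂ) * mode u 0 y * g y = ∫ y, (F y : ℂ) * mode u 0 y *
      (g y - MvPolynomial.eval ![toC y, (starRingEnd ℂ) (toC y)] P) := by
    simp only [mul_sub]
    rw [integral_sub (hint g hg) (hint _ hPc), integral_mul_polynomial_eq_zero hF h hu P, sub_zero]
  rw [e]
  refine (norm_integral_le_of_norm_le (hW.norm.mul_const (ε / (M + 1)))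
    (Filter.Eventually.of_forall fun y => ?_)).trans ?_
  · rw [norm_mul]
    rcases le_or_gt ‖y‖ (max R 1) with hy | hy
    · have hyK : toC y ∈ K := by simpa [K] using hy
      have := hP ⟨toC y, hyK⟩
      simp only [f, ContinuousMap.coe_mk, LinearIsometryEquiv.symm_apply_apply] at this
      gcongr
    · simp [hvan y hy]
  · rw [integral_mul_const, ← hM, zero_add, ← mul_div_assoc, div_le_iff₀ (by positivity)]
    nlinarith

/-- A locally integrable function orthogonal to all modes vanishes: multiplied by a radial cutoff,
all its moments `z^a z̄^b` vanish, and polynomials are dense by Stone–Weierstrass. -/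
lemma ae_eq_zero_of_integral_mode_eq_zero {F : Plane → ℝ} (hF : LocallyIntegrable F volume)
    (h : ∀ (k : ℕ) (u : ℝ → ℝ), IsHalfLineTest u → ∫ y, (F y : ℂ) * mode u k y = 0) :
    ∀ᵐ y ∂(volume : Measure Plane), F y = 0 := by
  have hcut : ∀ u, IsHalfLineTest u →
      ∀ᵐ y ∂(volume : Measure Plane), F y * u (‖y‖ ^ 2) = 0 := by
    intro u hu
    have hcont : Continuous (fun y : Plane => u (‖y‖ ^ 2)) :=
      hu.contDiff.continuous.comp (continuous_norm.pow 2)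
    have hloc : LocallyIntegrable (fun y => F y * u (‖y‖ ^ 2)) volume := by
      have := (hu.integrable_mode hF 0).re
      refine Integrable.locallyIntegrable (this.congr (Filter.Eventually.of_forall fun y => ?_))
      simp [mode]
    refine ae_eq_zero_of_integral_contDiff_smul_eq_zero hloc fun g hg _ => ?_
    have := integral_mul_continuous_eq_zero hF h hu
      (g := fun y => (g y : ℂ)) (Complex.continuous_ofReal.comp hg.continuous)
    simp only [mode, pow_zero, mul_one] at this
    norm_cast at this
    rw [← this]
    congr 1
    ext y
    simp [mul_comm]
  have hpos : ∀ n : ℕ, (1 : ℝ) / (n + 2) < n + 2 := fun n => by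
    rw [div_lt_iff₀ (by positivity)]
    have : (0 : ℝ) ≤ n := n.cast_nonneg
    nlinarith
  -- cutoffs positive exactly for `1 / (n + 2) < t < 2 (n + 2) - 1 / (n + 2)`
  let b : ∀ n : ℕ, ContDiffBump ((n : ℝ) + 2) := fun n =>
    ⟨((n + 2) - 1 / (n + 2)) / 2, (n + 2) - 1 / (n + 2), by linarith [hpos n], by
      linarith [hpos n]⟩
  have hb : ∀ n, IsHalfLineTest (b n) := fun n => by
    refine isHalfLineTest_contDiffBump (b n) ?_
    have : (0 : ℝ) < 1 / (n + 2) := by positivity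
    simp only [b]
    linarith
  have h0 : ∀ᵐ y ∂(volume : Measure Plane), y ≠ 0 := by simp [ae_iff]
  filter_upwards [ae_all_iff.2 fun n => hcut _ (hb n), h0] with y hy hy0
  have ht : 0 < ‖y‖ ^ 2 := by positivity
  obtain ⟨n, hn⟩ := exists_nat_gt (max (‖y‖ ^ 2) (‖y‖ ^ 2)⁻¹)
  have hn1 := (max_lt_iff.1 hn).1
  have hn2 := (max_lt_iff.1 hn).2
  have hlt : 1 / ((n : ℝ) + 2) < ‖y‖ ^ 2 := by
    rw [one_div]
    exact inv_lt_of_inv_lt₀ ht (by linarith)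
  have hmem : ‖y‖ ^ 2 ∈ Metric.ball ((n : ℝ) + 2) (b n).rOut := by
    rw [Metric.mem_ball, Real.dist_eq, abs_lt]
    simp only [b]
    constructor <;> linarith [hpos n]
  exact (mul_eq_zero.1 (hy n)).resolve_right ((b n).pos_of_mem_ball hmem).ne'

/-! ### The kernel -/

lemma continuous_regSol_norm_sq (m : ℕ) (κ : ℝ) :
    Continuous (fun y : Plane => regSol m κ (‖y‖ ^ 2)) := by
  unfold regSol
  refine continuous_const.add (Continuous.div (by fun_prop) (by fun_prop) fun y => ?_)
  positivity

lemma exists_ae_eq_mul_regSol {m : ℕ} (hm : Odd m) {φ : Plane → ℝ}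
    (h_even : ∀ᵐ y ∂(volume : Measure Plane), φ y = φ (-y))
    (h_energy : HasFiniteDirichletEnergy φ) (hφ : SolvesLinearizedLiouville (2 * m) φ) :
    ∃ γ : ℝ, ∀ᵐ y ∂(volume : Measure Plane), φ y = γ * regSol m 0 (‖y‖ ^ 2) := by
  obtain ⟨c, hc⟩ := exists_integral_mode_eq hm hφ (k := 0) hm.pos.ne
  set γ : ℝ := c.re / Real.pi with hγ
  have hZ : Continuous (fun y : Plane => γ * regSol m 0 (‖y‖ ^ 2)) :=
    (continuous_regSol_norm_sq m 0).const_mul γ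
  refine ⟨γ, ?_⟩
  have hF : LocallyIntegrable (fun y => φ y - γ * regSol m 0 (‖y‖ ^ 2)) volume :=
    hφ.1.sub hZ.locallyIntegrable
  suffices hs : ∀ (k : ℕ) (u : ℝ → ℝ), IsHalfLineTest u →
      ∫ y, ((φ y - γ * regSol m 0 (‖y‖ ^ 2) : ℝ) : ℂ) * mode u k y = 0 by
    filter_upwards [ae_eq_zero_of_integral_mode_eq_zero hF hs] with y hy
    exact sub_eq_zero.1 hy
  intro k u hu
  have e : ∀ y, ((φ y - γ * regSol m 0 (‖y‖ ^ 2) : ℝ) : ℂ) * mode u k y =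
      (φ y : ℂ) * mode u k y - ((γ * regSol m 0 (‖y‖ ^ 2) : ℝ) : ℂ) * mode u k y := fun y => by
    push_cast; ring
  simp only [e]
  rw [integral_sub (hu.integrable_mode hφ.1 k) (hu.integrable_mode hZ.locallyIntegrable k)]
  have eZ : ∀ y, ((γ * regSol m 0 (‖y‖ ^ 2) : ℝ) : ℂ) * mode u k y =
      mode (fun t => γ * (regSol m 0 t * u t)) k y := fun y => by
    simp only [mode]; push_cast; ring
  simp only [eZ]
  rcases eq_or_ne k 0 with rfl | hk
  · obtain ⟨-, a, R, ha, hua, -⟩ := id hu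
    have hI : ∫ t, t ^ 0 * regSol m (0 : ℕ) t * u t = ∫ t in Set.Ioi 0, regSol m 0 t * u t := by
      rw [setIntegral_eq_integral_of_forall_compl_eq_zero]
      · simp
      · intro t ht
        rw [hua t ((not_lt.1 ht).trans ha.le), mul_zero]
    have h1 := hc u hu
    rw [hI] at h1
    have hreal : ∀ v : ℝ → ℝ, ∀ y, mode v 0 y = ((v (‖y‖ ^ 2) : ℝ) : ℂ) := fun v y => by
      simp [mode]
    have h2 : ∫ y, mode (fun t => γ * (regSol m 0 t * u t)) 0 y =
        ((c.re * ∫ t in Set.Ioi 0, regSol m 0 t * u t : ℝ) : ℂ) := by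
      simp only [hreal]
      rw [integral_complex_ofReal, integral_const_mul,
        integral_comp_norm_sq (fun t => regSol m 0 t * u t), hγ]
      congr 1
      field_simp
    have h3 : ∫ y, (φ y : ℂ) * mode u 0 y = ((∫ y, φ y * u (‖y‖ ^ 2) : ℝ) : ℂ) := by
      rw [← integral_complex_ofReal]
      congr 1
      ext y
      simp [mode]
    -- the left-hand side of `h1` is real, so `c` may be replaced by its real part
    have h4 := congrArg Complex.re h1
    rw [h3, Complex.re_mul_ofReal, Complex.ofReal_re] at h4
    rw [h2, h3, h4, sub_self]
  · rw [integral_mode_eq_zero hk, sub_zero]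
    rcases Nat.even_or_odd k with hev | hodd
    · have hkm : k ≠ m := fun h => (Nat.not_even_iff_odd.2 hm) (h ▸ hev)
      exact integral_mode_eq_zero_of_energy hm hφ h_energy hk hkm hu
    · exact integral_mode_eq_zero_of_even h_even hodd u

theorem theorem5p1 (α : ℝ) (hα : ∃ m : ℕ, Odd m ∧ α / 2 = (m : ℝ))
    (φ : Plane → ℝ)
    (h_even : ∀ᵐ y ∂(volume : Measure Plane), φ y = φ (-y))
    (h_energy : HasFiniteDirichletEnergy φ)
    (h_eq : SolvesLinearizedLiouville α φ) :
    ∃ γ : ℝ,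
      (∀ᵐ y ∂(volume : Measure Plane), φ y = γ * ((1 - ‖y‖ ^ α) / (1 + ‖y‖ ^ α))) ∧
      (Continuous φ → ∀ y : Plane, φ y = γ * ((1 - ‖y‖ ^ α) / (1 + ‖y‖ ^ α))) := by
  obtain ⟨m, hm, hαm⟩ := hα
  obtain rfl : α = 2 * m := by linarith
  obtain ⟨γ, hγ⟩ := exists_ae_eq_mul_regSol hm h_even h_energy h_eq
  have hZ : ∀ y : Plane, γ * regSol m 0 (‖y‖ ^ 2) =
      γ * m * ((1 - ‖y‖ ^ (2 * m : ℝ)) / (1 + ‖y‖ ^ (2 * m : ℝ))) := fun y => by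
    have hx : 1 + (‖y‖ ^ 2) ^ m ≠ 0 := by positivity
    rw [rpow_two_mul_natCast, regSol]
    field_simp
    ring
  refine ⟨γ * m, ?_, fun hc y => ?_⟩
  · filter_upwards [hγ] with y hy
    rw [hy, hZ]
  · rw [← hZ]
    exact congrFun ((Continuous.ae_eq_iff_eq volume hc
      ((continuous_regSol_norm_sq m 0).const_mul γ)).1 hγ) y
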